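/- All graphs are finite, simple and undirected, and $G$ is \emph{$H$-free} if no induced subgraph of $G$ is isomorphic to $H$. A set $D\subseteq V(G)$ is a \emph{semitotal dominating set} of $G$ if every vertex of $V(G)\setminus D$ has a neighbour in $D$ and every vertex of $D$ is at distance at most two from another vertex of $D$; $\gamma_{t2}(G)$ denotes the minimum size of a semitotal dominating set of $G$. Contracting an edge $xy$ removes $x$ and $y$ and replaces them with a new vertex adjacent to precisely the remaining vertices that were adjacent to $x$ or $y$ (no loops, no multiple edges). Let $ct_{\gamma_{t2}}(G)$ be the minimum number of edge contractions that turn $G$ into a graph $H$ with $\gamma_{t2}(H)=\gamma_{t2}(G)-1$ ($\infty$ if this is impossible). Let $P_n$ be the path on $n$ vertices and $2P_4$ the disjoint union of two copies of $P_4$. Let $G$ be a connected graph with at least two vertices and $\gamma_{t2}(G)\ge 3$. If $G$ is $P_8$-free, then $ct_{\gamma_{t2}}(G)\le 2$. If $G$ is $2P_4$-free, then $ct_{\gamma_{t2}}(G)\le 2$. -/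

import Mathlib

universe u

namespace SemitotalContraction

/-- `D` is a semitotal dominating set of `G`: every vertex outside `D` has a neighbour in `D`, and
every vertex of `D` is at distance at most two from another vertex of `D`. -/
def IsSemitotalDominating {V : Type u} (G : SimpleGraph V) (D : Finset V) : Prop :=
  (∀ v : V, v ∉ D → ∃ w ∈ D, G.Adj v w) ∧
    ∀ x ∈ D, ∃ y ∈ D, y ≠ x ∧ G.edist x y ≤ 2

/-- The semitotal domination number: the minimum size of a semitotal dominating set. (Every finite
connected graph with at least two vertices has such a set; the value is `0` if there is none.) -/
noncomputable def semitotalDominationNumber {V : Type u} (G : SimpleGraph V) : ℕ :=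
  sInf {n : ℕ | ∃ D : Finset V, IsSemitotalDominating G D ∧ D.card = n}

/-- The contraction of the edge `xy`: the vertices `x` and `y` are removed and replaced with a new
vertex `none`, adjacent to precisely the remaining vertices that were adjacent to `x` or `y`. -/
def contractEdge {V : Type u} (G : SimpleGraph V) (x y : V) :
    SimpleGraph (Option {v : V // v ≠ x ∧ v ≠ y}) where
  Adj a b :=
    match a, b with
    | none, none => False
    | none, some w => G.Adj x w ∨ G.Adj y w
    | some v, none => G.Adj x v ∨ G.Adj y v
    | some v, some w => G.Adj v w
  symm := ⟨by
    rintro (_ | v) (_ | w) h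
    · exact h
    · exact h
    · exact h
    · exact G.adj_symm h⟩
  loopless := ⟨by
    rintro (_ | v) h
    · exact h
    · exact G.irrefl h⟩

/-- `H` is obtained, up to isomorphism, from `G` by a sequence of exactly `k` edge contractions. -/
def ContractsTo : ℕ → ∀ {V W : Type u}, SimpleGraph V → SimpleGraph W → Prop
  | 0, _, _, G, H => Nonempty (G ≃g H)
  | k + 1, _, _, G, H => ∃ x y, G.Adj x y ∧ ContractsTo k (contractEdge G x y) H

/-- The minimum number of edge contractions that turn `G` into a graph `H` with `π H = π G - 1`
(`⊤` if no sequence of edge contractions does). -/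
noncomputable def contractionNumber (π : ∀ {V : Type u}, SimpleGraph V → ℕ)
    {V : Type u} (G : SimpleGraph V) : ℕ∞ :=
  sInf {n : ℕ∞ | ∃ k : ℕ, n = k ∧
    ∃ (W : Type u) (H : SimpleGraph W), ContractsTo k G H ∧ π H + 1 = π G}

/-- `G` is `H`-free: no induced subgraph of `G` is isomorphic to `H`. -/
def IsFree {U : Type*} {V : Type u} (H : SimpleGraph U) (G : SimpleGraph V) : Prop :=
  ¬ H.IsIndContained G

end SemitotalContraction

/-!
Suppose that two contractions do not suffice, and let `D` be a minimum semitotal dominating set.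

Contracting an edge lowers the semitotal domination number by at most one
(`semitotalDominationNumber_le_contractEdge_add_one`). So it is enough to reach a semitotal
dominating set smaller than `D` with at most two contractions; the lemmas
`contractionNumber_le_two_of_edge`, `contractionNumber_le_two_of_path` and
`contractionNumber_le_two_of_two_edges` do so from dominating sets containing an edge, a path on
three vertices or two disjoint edges.

Hence `D` has a rigid structure: it is independent (`IsStubborn.not_adj`), and it splits into pairs
`x, y` with a common neighbour `c` such that all other vertices of `D` are at distance at least
three from `x`, `y` and every such `c` (`IsStubborn.far`). Moreover `D` cannot be changed to
`(D \ {x}) ∪ {c}`, so `x` has a private neighbour, one that this set does not dominate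
(`IsStubborn.exists_isPrivate`).

Take two pairs joined by a path `y a b x'`, with centres `c` and `c'`.

* If `u` and `u'` are private neighbours of `x` and `x'`, then `uxcy` and `u'x'c'y'` induce `2P₄`
  unless `u` and `u'` are adjacent. If they always are, then `(D \ {x}) ∪ {c, u'}` is dominating,
  and its edges `yc` and `x'u'` can be contracted; the two new vertices are close to each other
  through a private neighbour of `y`, which is adjacent to `u'` too.
* If `a` is not adjacent to `c` and `b` is not adjacent to `c'`, then `x c y a b x' c' y'` is an
  induced `P₈`. If `a` is adjacent to `c`, some private neighbour `u` of `x` is not adjacent to `a`,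
  as otherwise the triangle `yac` of the dominating set `(D \ {x}) ∪ {a, c}` can be contracted; then
  the detour `u x c a` replaces `x c y a`. The same holds on the other side, and each of the
  cases gives an induced `P₈`.
-/

namespace SemitotalContraction

/-! ### Contractions and semitotal dominating sets -/

section

open scoped Classical

variable {V W : Type u} {G : SimpleGraph V} {H : SimpleGraph W}

/-- `u` and `v` are joined by a walk of length one or two. -/
def Near (G : SimpleGraph V) (u v : V) : Prop :=
  G.Adj u v ∨ ∃ w, G.Adj u w ∧ G.Adj w v

theorem Near.symm {u v : V} (h : Near G u v) : Near G v u := by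
  rcases h with h | ⟨w, h1, h2⟩
  · exact .inl h.symm
  · exact .inr ⟨w, h2.symm, h1.symm⟩

theorem Near.edist_le {u v : V} (h : Near G u v) : G.edist u v ≤ 2 := by
  rcases h with h | ⟨w, h1, h2⟩
  · exact (SimpleGraph.Walk.edist_le (.cons h .nil)).trans (by simp)
  · exact (SimpleGraph.Walk.edist_le (.cons h1 (.cons h2 .nil))).trans (by simp)

theorem near_of_edist_le {u v : V} (hne : u ≠ v) (h : G.edist u v ≤ 2) : Near G u v := by
  obtain ⟨p, hp⟩ := SimpleGraph.exists_walk_of_edist_ne_top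
    (ne_top_of_le_ne_top (by simp) h : G.edist u v ≠ ⊤)
  rw [← hp] at h
  have h2 : p.length ≤ 2 := by exact_mod_cast h
  match p, h2 with
  | .nil, _ => exact absurd rfl hne
  | .cons h1 .nil, _ => exact .inl h1
  | .cons h1 (.cons h2 .nil), _ => exact .inr ⟨_, h1, h2⟩
  | .cons _ (.cons _ (.cons _ _)), h => simp at h

/-- Every vertex outside `D` has a neighbour in `D`. -/
def Dominates (G : SimpleGraph V) (D : Finset V) : Prop :=
  ∀ v, v ∉ D → ∃ w ∈ D, G.Adj v w

theorem isSemitotalDominating_iff {D : Finset V} : IsSemitotalDominating G D ↔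
    Dominates G D ∧ ∀ x ∈ D, ∃ y ∈ D, y ≠ x ∧ Near G x y := by
  refine and_congr Iff.rfl (forall₂_congr fun x _ => exists_congr fun y => and_congr Iff.rfl ?_)
  exact and_congr_right fun hne => ⟨near_of_edist_le hne.symm, Near.edist_le⟩

theorem semitotalDominationNumber_le {D : Finset V} (h : IsSemitotalDominating G D) :
    semitotalDominationNumber G ≤ D.card :=
  Nat.sInf_le ⟨D, h, rfl⟩

theorem exists_card_eq_semitotalDominationNumber
    (h : ∃ D : Finset V, IsSemitotalDominating G D) :
    ∃ D, IsSemitotalDominating G D ∧ D.card = semitotalDominationNumber G :=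
  let ⟨D, hD⟩ := h
  Nat.sInf_mem (s := {n | ∃ D : Finset V, IsSemitotalDominating G D ∧ D.card = n}) ⟨_, D, hD, rfl⟩

/-- The image of a dominating set under a vertex-identifying map is semitotal dominating as soon as
every merged vertex has a witness that is not merged into it; the witness may be close to any
vertex `d'` of the fibre, whether in `D` or not. -/
theorem isSemitotalDominating_image [DecidableEq W] {f : V → W} (hsurj : Function.Surjective f)
    (hf : ∀ u v, G.Adj u v → f u = f v ∨ H.Adj (f u) (f v)) {D : Finset V} (hD : Dominates G D)
    (hw : ∀ d ∈ D, ∃ d' e, f d' = f d ∧ e ∈ D ∧ f e ≠ f d ∧ Near G d' e) :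
    IsSemitotalDominating H (D.image f) := by
  rw [isSemitotalDominating_iff]
  constructor
  · intro w hw'
    obtain ⟨v, rfl⟩ := hsurj w
    have hv : v ∉ D := fun h => hw' (Finset.mem_image_of_mem f h)
    obtain ⟨d, hd, hvd⟩ := hD v hv
    refine ⟨f d, Finset.mem_image_of_mem f hd, (hf v d hvd).resolve_left fun h => hw' ?_⟩
    exact h ▸ Finset.mem_image_of_mem f hd
  · intro w hw'
    obtain ⟨d, hd, rfl⟩ := Finset.mem_image.1 hw'
    obtain ⟨d', e, h1, he, hne, hn⟩ := hw d hd
    refine ⟨f e, Finset.mem_image_of_mem f he, hne, ?_⟩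
    rw [← h1] at hne ⊢
    rcases hn with h | ⟨t, ht1, ht2⟩
    · exact .inl ((hf _ _ h).resolve_left hne.symm)
    · rcases hf _ _ ht1 with h | h
      · rw [h] at hne ⊢
        exact .inl ((hf _ _ ht2).resolve_left hne.symm)
      · rcases hf _ _ ht2 with h' | h'
        · exact .inl (h' ▸ h)
        · exact .inr ⟨_, h, h'⟩

/-- The projection onto the contraction of `xy`, sending `x` and `y` to the new vertex. -/
noncomputable def contractProj (x y : V) (v : V) : Option {v : V // v ≠ x ∧ v ≠ y} :=
  if h : v ≠ x ∧ v ≠ y then some ⟨v, h⟩ else none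

theorem contractProj_eq_iff {x y u v : V} : contractProj x y u = contractProj x y v ↔
    u = v ∨ ((u = x ∨ u = y) ∧ (v = x ∨ v = y)) := by
  unfold contractProj
  split_ifs with h1 h2 h2 <;> simp <;> grind

theorem contractProj_surjective (x y : V) : Function.Surjective (contractProj x y) := by
  rintro (_ | ⟨v, hv⟩)
  · exact ⟨x, by simp [contractProj]⟩
  · exact ⟨v, by simp [contractProj, hv]⟩

theorem contractProj_adj {x y u v : V} (h : G.Adj u v) :
    contractProj x y u = contractProj x y v ∨
      (contractEdge G x y).Adj (contractProj x y u) (contractProj x y v) := by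
  unfold contractProj
  have h' := h.symm
  split_ifs with h1 h2 h2
  · exact .inr h
  · have : v = x ∨ v = y := by grind
    rcases this with rfl | rfl
    · exact .inr (.inl h')
    · exact .inr (.inr h')
  · have : u = x ∨ u = y := by grind
    rcases this with rfl | rfl
    · exact .inr (.inl h)
    · exact .inr (.inr h)
  · exact .inl rfl

/-- One contraction lowers the semitotal domination number by at most one. If the new vertex is in
the set, it is replaced by both ends of the edge; otherwise an end with a neighbour in the set
is added. -/
theorem exists_isSemitotalDominating_of_contractEdge {x y : V} (hxy : G.Adj x y)
    {D : Finset (Option {v : V // v ≠ x ∧ v ≠ y})}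
    (hD : IsSemitotalDominating (contractEdge G x y) D) :
    ∃ E : Finset V, IsSemitotalDominating G E ∧ E.card ≤ D.card + 1 := by
  rw [isSemitotalDominating_iff] at hD
  obtain ⟨hdom, hwit⟩ := hD
  have hyx := hxy.symm
  -- A vertex close to another one in the contraction is, in `G`, close to it or adjacent to an end.
  have hnear : ∀ d e, Near (contractEdge G x y) (some d) (some e) →
      Near G d e ∨ G.Adj d x ∨ G.Adj d y := by
    rintro d e (h | ⟨_ | w, h1, h2⟩)
    · exact .inl (.inl h)
    · exact .inr (h1.imp G.adj_symm G.adj_symm)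
    · exact .inl (.inr ⟨w, h1, h2⟩)
  have hnear_none : ∀ d, Near (contractEdge G x y) (some d) none → Near G d x ∨ Near G d y := by
    rintro d (h | ⟨_ | w, h1, h2⟩)
    · exact (show G.Adj x d ∨ G.Adj y d from h).imp (fun h => .inl h.symm) (fun h => .inl h.symm)
    · exact absurd h2 (SimpleGraph.irrefl _)
    · exact (show G.Adj x w ∨ G.Adj y w from h2).imp (fun h => .inr ⟨w, h1, h.symm⟩)
        (fun h => .inr ⟨w, h1, h.symm⟩)
  set g : Option {v : V // v ≠ x ∧ v ≠ y} → V := fun o => o.elim x Subtype.val with hg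
  have hcard : ∀ z, (insert z (D.image g)).card ≤ D.card + 1 := fun z =>
    (Finset.card_insert_le _ _).trans (Nat.add_le_add_right Finset.card_image_le 1)
  by_cases hnone : none ∈ D
  · have hx : x ∈ D.image g := Finset.mem_image.2 ⟨none, hnone, rfl⟩
    refine ⟨insert y (D.image g), isSemitotalDominating_iff.2 ⟨?_, ?_⟩, hcard y⟩
    · intro v hv
      have hvx : v ≠ x := fun h => hv (by rw [h]; exact Finset.mem_insert_of_mem hx)
      have hvy : v ≠ y := fun h => hv (by rw [h]; exact Finset.mem_insert_self _ _)
      have hvD : some ⟨v, hvx, hvy⟩ ∉ D := fun h =>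
        hv (Finset.mem_insert_of_mem (Finset.mem_image.2 ⟨_, h, rfl⟩))
      obtain ⟨_ | w, hw, hvw⟩ := hdom _ hvD
      · rcases hvw with h | h
        · exact ⟨x, Finset.mem_insert_of_mem hx, h.symm⟩
        · exact ⟨y, Finset.mem_insert_self _ _, h.symm⟩
      · exact ⟨w, Finset.mem_insert_of_mem (Finset.mem_image.2 ⟨_, hw, rfl⟩), hvw⟩
    · intro v hv
      rcases Finset.mem_insert.1 hv with h | hv
      · rw [h]
        exact ⟨x, Finset.mem_insert_of_mem hx, hxy.ne, .inl hyx⟩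
      obtain ⟨_ | d, hd, rfl⟩ := Finset.mem_image.1 hv
      · exact ⟨y, Finset.mem_insert_self _ _, hyx.ne, .inl hxy⟩
      have key : Near G d x ∨ Near G d y →
          ∃ e ∈ insert y (D.image g), e ≠ d ∧ Near G d e := by
        rintro (h | h)
        · exact ⟨x, Finset.mem_insert_of_mem hx, d.2.1.symm, h⟩
        · exact ⟨y, Finset.mem_insert_self _ _, d.2.2.symm, h⟩
      obtain ⟨_ | e, he, hne, h⟩ := hwit _ hd
      · exact key (hnear_none d h)
      · rcases hnear d e h with h | h | h
        · exact ⟨e, Finset.mem_insert_of_mem (Finset.mem_image.2 ⟨_, he, rfl⟩),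
            fun h => hne (congrArg some (Subtype.ext h)), h⟩
        · exact key (.inl (.inl h))
        · exact key (.inr (.inl h))
  · obtain ⟨_ | d, hd, hnd⟩ := hdom none hnone
    · exact absurd hd hnone
    obtain ⟨z, z', hz, hz', hzz, hzd⟩ : ∃ z z', (z = x ∨ z = y) ∧
        (∀ v, v = x ∨ v = y → v = z ∨ v = z') ∧ G.Adj z' z ∧ G.Adj z d := by
      rcases hnd with h | h
      · exact ⟨x, y, .inl rfl, fun v hv => hv, hyx, h⟩
      · exact ⟨y, x, .inr rfl, fun v hv => hv.symm, hxy, h⟩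
    have hgz : ∀ v : {v : V // v ≠ x ∧ v ≠ y}, z ≠ v := by
      rintro v rfl
      exact hz.elim v.2.1 v.2.2
    refine ⟨insert z (D.image g), isSemitotalDominating_iff.2 ⟨?_, ?_⟩, hcard z⟩
    · intro v hv
      have hvz : v ≠ z := fun h => hv (by rw [h]; exact Finset.mem_insert_self _ _)
      by_cases hvxy : v = x ∨ v = y
      · exact ⟨z, Finset.mem_insert_self _ _, ((hz' v hvxy).resolve_left hvz) ▸ hzz⟩
      · have hvD : some ⟨v, not_or.1 hvxy⟩ ∉ D := fun h =>
          hv (Finset.mem_insert_of_mem (Finset.mem_image.2 ⟨_, h, rfl⟩))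
        obtain ⟨_ | w, hw, hvw⟩ := hdom _ hvD
        · exact absurd hw hnone
        · exact ⟨w, Finset.mem_insert_of_mem (Finset.mem_image.2 ⟨_, hw, rfl⟩), hvw⟩
    · intro v hv
      rcases Finset.mem_insert.1 hv with rfl | hv
      · exact ⟨d, Finset.mem_insert_of_mem (Finset.mem_image.2 ⟨_, hd, rfl⟩), (hgz d).symm,
          .inl hzd⟩
      obtain ⟨_ | v, hv', rfl⟩ := Finset.mem_image.1 hv
      · exact absurd hv' hnone
      have key : G.Adj v x ∨ G.Adj v y → ∃ e ∈ insert z (D.image g), e ≠ v ∧ Near G v e := by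
        intro h
        refine ⟨z, Finset.mem_insert_self _ _, hgz v, ?_⟩
        obtain ⟨t, ht, hvt⟩ : ∃ t, (t = x ∨ t = y) ∧ G.Adj v t :=
          h.elim (fun h => ⟨x, .inl rfl, h⟩) (fun h => ⟨y, .inr rfl, h⟩)
        rcases hz' t ht with rfl | rfl
        · exact .inl hvt
        · exact .inr ⟨t, hvt, hzz⟩
      obtain ⟨_ | e, he, hne, h⟩ := hwit _ hv'
      · exact absurd he hnone
      · rcases hnear v e h with h | h
        · exact ⟨e, Finset.mem_insert_of_mem (Finset.mem_image.2 ⟨_, he, rfl⟩),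
            fun h => hne (congrArg some (Subtype.ext h)), h⟩
        · exact key h

theorem semitotalDominationNumber_le_contractEdge_add_one {x y : V} (hxy : G.Adj x y)
    (h : ∃ D, IsSemitotalDominating (contractEdge G x y) D) :
    semitotalDominationNumber G ≤ semitotalDominationNumber (contractEdge G x y) + 1 := by
  obtain ⟨D, hD, hc⟩ := exists_card_eq_semitotalDominationNumber h
  obtain ⟨E, hE, hEc⟩ := exists_isSemitotalDominating_of_contractEdge hxy hD
  exact (semitotalDominationNumber_le hE).trans (hc ▸ hEc)

theorem contractionNumber_le_of_contractsTo {k : ℕ} (hk : k ≤ 2) (h : ContractsTo k G H)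
    (hπ : semitotalDominationNumber H + 1 = semitotalDominationNumber G) :
    contractionNumber semitotalDominationNumber G ≤ 2 := by
  have h' : contractionNumber semitotalDominationNumber G ≤ (k : ℕ∞) :=
    sInf_le ⟨k, rfl, W, H, h, hπ⟩
  exact h'.trans (by exact_mod_cast hk)

theorem contractionNumber_le_two_of_contractEdge {x y : V} (hxy : G.Adj x y)
    {D : Finset (Option {v : V // v ≠ x ∧ v ≠ y})}
    (hD : IsSemitotalDominating (contractEdge G x y) D)
    (hc : D.card + 1 ≤ semitotalDominationNumber G) :
    contractionNumber semitotalDominationNumber G ≤ 2 := by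
  refine contractionNumber_le_of_contractsTo one_le_two
    ⟨x, y, hxy, ⟨SimpleGraph.Iso.refl⟩⟩ (le_antisymm ?_ ?_)
  · exact (Nat.add_le_add_right (semitotalDominationNumber_le hD) 1).trans hc
  · exact semitotalDominationNumber_le_contractEdge_add_one hxy ⟨D, hD⟩

/-- Since each contraction lowers the semitotal domination number by at most one, a small set in
the graph after two contractions forces the value one less than that of `G` to occur after
one or two contractions. -/
theorem contractionNumber_le_two_of_contractEdge_contractEdge {x y : V} (hxy : G.Adj x y)
    {p q : Option {v : V // v ≠ x ∧ v ≠ y}} (hpq : (contractEdge G x y).Adj p q)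
    {D : Finset (Option {v // v ≠ p ∧ v ≠ q})}
    (hD : IsSemitotalDominating (contractEdge (contractEdge G x y) p q) D)
    (hc : D.card + 1 ≤ semitotalDominationNumber G) :
    contractionNumber semitotalDominationNumber G ≤ 2 := by
  obtain ⟨E, hE, -⟩ := exists_isSemitotalDominating_of_contractEdge hpq hD
  have h1 := semitotalDominationNumber_le_contractEdge_add_one hxy ⟨E, hE⟩
  have h2 := semitotalDominationNumber_le_contractEdge_add_one hpq ⟨D, hD⟩
  have h3 := semitotalDominationNumber_le hD
  by_cases h : semitotalDominationNumber (contractEdge G x y) + 1 = semitotalDominationNumber G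
  · exact contractionNumber_le_of_contractsTo one_le_two ⟨x, y, hxy, ⟨SimpleGraph.Iso.refl⟩⟩ h
  · exact contractionNumber_le_of_contractsTo le_rfl
      ⟨x, y, hxy, p, q, hpq, ⟨SimpleGraph.Iso.refl⟩⟩ (by omega)

/-- Contracting an edge `pq` of `D`; the vertex `z` near `p` or `q` is the witness for the new
vertex. -/
theorem contractionNumber_le_two_of_edge {D : Finset V} (hD : Dominates G D)
    (hc : D.card ≤ semitotalDominationNumber G) {p q z t : V} (hpq : G.Adj p q)
    (hp : p ∈ D) (hq : q ∈ D) (hw : ∀ d ∈ D, d ≠ p → d ≠ q → ∃ e ∈ D, e ≠ d ∧ Near G d e)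
    (ht : t = p ∨ t = q) (hz : z ∈ D) (hzp : z ≠ p) (hzq : z ≠ q) (htz : Near G t z) :
    contractionNumber semitotalDominationNumber G ≤ 2 := by
  have hS := isSemitotalDominating_image (contractProj_surjective p q)
    (fun u v => contractProj_adj (G := G)) hD fun d hd => by
      simp only [ne_eq, contractProj_eq_iff]
      by_cases h : d = p ∨ d = q
      · exact ⟨t, z, by tauto, hz, by grind, htz⟩
      · obtain ⟨e, he, hne, hn⟩ := hw d hd (by tauto) (by tauto)
        exact ⟨d, e, .inl rfl, he, by grind, hn⟩
  refine contractionNumber_le_two_of_contractEdge hpq hS (le_trans ?_ hc)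
  have : D.image (contractProj p q) ⊆ (D.erase q).image (contractProj p q) := by
    intro w hw'
    obtain ⟨d, hd, rfl⟩ := Finset.mem_image.1 hw'
    by_cases h : d = q
    · exact Finset.mem_image.2 ⟨p, by simp [hp, hpq.ne], contractProj_eq_iff.2 (by simp [h])⟩
    · exact Finset.mem_image_of_mem _ (by simp [h, hd])
  have h1 := (Finset.card_le_card this).trans Finset.card_image_le
  have h2 := Finset.card_erase_add_one hq
  omega

/-- Two contractions, phrased through the composite projection `f`; the set may have one vertex
more than a minimum one, as it loses the two vertices `u` and `v`. -/
theorem contractionNumber_le_two_of_image {D : Finset V} (hD : Dominates G D)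
    (hc : D.card ≤ semitotalDominationNumber G + 1) {p q r s : V} (hpq : G.Adj p q)
    (hrs : G.Adj r s) (hne : contractProj p q r ≠ contractProj p q s)
    {f : V → Option {w // w ≠ contractProj p q r ∧ w ≠ contractProj p q s}}
    (hf : f = contractProj (contractProj p q r) (contractProj p q s) ∘ contractProj p q)
    (hw : ∀ d ∈ D, ∃ d' e, f d' = f d ∧ e ∈ D ∧ f e ≠ f d ∧ Near G d' e)
    {u v : V} (hu : u ∈ D) (hv : v ∈ D) (huv : u ≠ v)
    (hu' : ∃ d ∈ D, d ≠ u ∧ d ≠ v ∧ f d = f u) (hv' : ∃ d ∈ D, d ≠ u ∧ d ≠ v ∧ f d = f v) :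
    contractionNumber semitotalDominationNumber G ≤ 2 := by
  have hadj := (contractProj_adj hrs (x := p) (y := q)).resolve_left hne
  have hS := isSemitotalDominating_image (f := f)
    (H := contractEdge (contractEdge G p q) (contractProj p q r) (contractProj p q s))
    (hf ▸ (contractProj_surjective _ _).comp (contractProj_surjective _ _))
    (fun u v huv => by
      subst hf
      rcases contractProj_adj huv (x := p) (y := q) with h | h
      · exact .inl (congrArg (contractProj _ _) h)
      · exact contractProj_adj h) hD hw
  refine contractionNumber_le_two_of_contractEdge_contractEdge hpq hadj hS ?_
  have : D.image f ⊆ ((D.erase u).erase v).image f := by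
    intro w hw'
    obtain ⟨d, hd, rfl⟩ := Finset.mem_image.1 hw'
    simp only [Finset.mem_image, Finset.mem_erase]
    grind
  have h1 := (Finset.card_le_card this).trans Finset.card_image_le
  have h2 := Finset.card_erase_add_one hu
  have h3 := Finset.card_erase_add_one (Finset.mem_erase.2 ⟨huv.symm, hv⟩)
  omega

/-- Contracting a path `pqr` of `D` to a single vertex, for which `z` is the witness. -/
theorem contractionNumber_le_two_of_path {D : Finset V} (hD : Dominates G D)
    (hc : D.card ≤ semitotalDominationNumber G + 1) {p q r z t : V} (hpq : G.Adj p q)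
    (hqr : G.Adj q r) (hpr : p ≠ r) (hp : p ∈ D) (hq : q ∈ D) (hr : r ∈ D)
    (hw : ∀ d ∈ D, d ≠ p → d ≠ q → d ≠ r → ∃ e ∈ D, e ≠ d ∧ Near G d e)
    (ht : t = p ∨ t = q ∨ t = r) (hz : z ∈ D) (hzp : z ≠ p) (hzq : z ≠ q) (hzr : z ≠ r)
    (htz : Near G t z) : contractionNumber semitotalDominationNumber G ≤ 2 := by
  have h1 := hpq.ne
  have h2 := hqr.ne
  obtain ⟨f, hf⟩ : ∃ f, f = contractProj (contractProj p q q) (contractProj p q r) ∘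
    contractProj p q := ⟨_, rfl⟩
  have hfe : ∀ u v, f u = f v ↔
      u = v ∨ ((u = p ∨ u = q ∨ u = r) ∧ (v = p ∨ v = q ∨ v = r)) := by
    intro u v
    simp only [hf, Function.comp_apply, contractProj_eq_iff]
    grind
  refine contractionNumber_le_two_of_image hD hc hpq hqr ?_ hf ?_ hq hr h2
    ⟨p, hp, h1, hpr, ?_⟩ ⟨p, hp, h1, hpr, ?_⟩
  · simp only [ne_eq, contractProj_eq_iff]
    grind
  · intro d hd
    simp only [ne_eq, hfe]
    by_cases h : d = p ∨ d = q ∨ d = r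
    · exact ⟨t, z, .inr ⟨ht, h⟩, hz, by grind, htz⟩
    · obtain ⟨e, he, hne, hn⟩ := hw d hd (by tauto) (by tauto) (by tauto)
      exact ⟨d, e, .inl rfl, he, by grind, hn⟩
  all_goals simp [hfe]

/-- Contracting two disjoint edges `pq` and `rs` of `D` that are at distance at most two. -/
theorem contractionNumber_le_two_of_two_edges {D : Finset V} (hD : Dominates G D)
    (hc : D.card ≤ semitotalDominationNumber G + 1) {p q r s : V} (hpq : G.Adj p q)
    (hrs : G.Adj r s) (hpr : p ≠ r) (hps : p ≠ s) (hqr : q ≠ r) (hqs : q ≠ s)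
    (hp : p ∈ D) (hq : q ∈ D) (hr : r ∈ D) (hs : s ∈ D)
    (hw : ∀ d ∈ D, d ≠ p → d ≠ q → d ≠ r → d ≠ s → ∃ e ∈ D, e ≠ d ∧ Near G d e)
    (hn : Near G p r) : contractionNumber semitotalDominationNumber G ≤ 2 := by
  have h1 := hpq.ne
  have h2 := hrs.ne
  obtain ⟨f, hf⟩ : ∃ f, f = contractProj (contractProj p q r) (contractProj p q s) ∘
    contractProj p q := ⟨_, rfl⟩
  have hfe : ∀ u v, f u = f v ↔
      u = v ∨ ((u = p ∨ u = q) ∧ (v = p ∨ v = q)) ∨ ((u = r ∨ u = s) ∧ (v = r ∨ v = s)) := by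
    intro u v
    simp only [hf, Function.comp_apply, contractProj_eq_iff]
    grind
  refine contractionNumber_le_two_of_image hD hc hpq hrs ?_ hf ?_ hq hs hqs
    ⟨p, hp, h1, hps, ?_⟩ ⟨r, hr, hqr.symm, h2, ?_⟩
  · simp only [ne_eq, contractProj_eq_iff]
    grind
  · intro d hd
    simp only [ne_eq, hfe]
    by_cases h : d = p ∨ d = q
    · exact ⟨p, r, by tauto, hr, by grind, hn⟩
    by_cases h' : d = r ∨ d = s
    · exact ⟨r, p, by tauto, hp, by grind, hn.symm⟩
    · obtain ⟨e, he, hne, hn⟩ := hw d hd (by tauto) (by tauto) (by tauto) (by tauto)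
      exact ⟨d, e, .inl rfl, he, by grind, hn⟩
  all_goals simp [hfe]

end

/-! ### The structure of a stubborn minimum set -/

section

open scoped Classical

variable {V : Type u} {G : SimpleGraph V} {D : Finset V}

/-- A minimum semitotal dominating set `D` of a connected graph `G` whose semitotal domination
number is at least three and cannot be lowered by at most two contractions. -/
structure IsStubborn (G : SimpleGraph V) (D : Finset V) : Prop where
  connected : G.Connected
  three_le : 3 ≤ D.card
  semitotal : IsSemitotalDominating G D
  card_eq : D.card = semitotalDominationNumber G
  not_le : ¬ contractionNumber semitotalDominationNumber G ≤ 2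

/-- `c` is a common neighbour of the distinct vertices `x` and `y` of `D`. -/
structure IsCherry (G : SimpleGraph V) (D : Finset V) (x c y : V) : Prop where
  left_mem : x ∈ D
  right_mem : y ∈ D
  ne : x ≠ y
  adj_left : G.Adj x c
  adj_right : G.Adj c y

/-- `u` is a neighbour of `x` without a neighbour in `(D \ {x}) ∪ {c}`. If `D` is independent, then
`u` is outside `D`, so it is no longer dominated when `x` is replaced by `c`. -/
structure IsPrivate (G : SimpleGraph V) (D : Finset V) (x c u : V) : Prop where
  adj : G.Adj x u
  not_adj_center : ¬ G.Adj c u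
  not_adj : ∀ d ∈ D, d ≠ x → ¬ G.Adj d u

/-- `u` and `v` are at distance at least three. -/
structure Far (G : SimpleGraph V) (u v : V) : Prop where
  ne : u ≠ v
  not_adj : ¬ G.Adj u v
  not_adj_of_adj : ∀ w, G.Adj u w → ¬ G.Adj w v

theorem far_of_not_near {u v : V} (hne : u ≠ v) (h : ¬ Near G u v) : Far G u v :=
  ⟨hne, fun h' => h (.inl h'), fun w h1 h2 => h (.inr ⟨w, h1, h2⟩)⟩

theorem Far.not_near {u v : V} (h : Far G u v) : ¬ Near G u v := by
  rintro (h' | ⟨w, h1, h2⟩)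
  · exact h.not_adj h'
  · exact h.not_adj_of_adj w h1 h2

theorem Far.symm {u v : V} (h : Far G u v) : Far G v u :=
  far_of_not_near h.ne.symm fun h' => h.not_near h'.symm

theorem IsCherry.symm {x c y : V} (h : IsCherry G D x c y) : IsCherry G D y c x :=
  ⟨h.right_mem, h.left_mem, h.ne.symm, h.adj_right.symm, h.adj_left.symm⟩

/-- In a connected graph, the vertices of a dominating set `D` other than `x` and `y`, if any, are
not all at distance more than three from both `x` and `y`. -/
theorem exists_near_or_path (hG : G.Connected) (hD : Dominates G D) {x y z : V} (hz : z ∈ D)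
    (hzx : z ≠ x) (hzy : z ≠ y) : ∃ d e, (d = x ∨ d = y) ∧ e ∈ D ∧ e ≠ x ∧ e ≠ y ∧
      (Near G d e ∨ ∃ a b, G.Adj d a ∧ G.Adj a b ∧ G.Adj b e) := by
  set S : Set V := {v | ∃ d, (d = x ∨ d = y) ∧ (v = d ∨ G.Adj d v)} with hS
  by_cases hzS : z ∈ S
  · obtain ⟨d, hd, rfl | h⟩ := hzS
    · exact absurd hd (by tauto)
    · exact ⟨d, z, hd, hz, hzx, hzy, .inl (.inl h)⟩
  obtain ⟨p⟩ := hG.preconnected x z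
  obtain ⟨e, -, h1, h2⟩ := p.exists_boundary_dart S ⟨x, .inl rfl, .inl rfl⟩ hzS
  obtain ⟨⟨a, b⟩, hab⟩ := e
  obtain ⟨d, hd, had⟩ := h1
  replace hab : G.Adj a b := hab
  replace h2 : b ∉ S := h2
  have hda : G.Adj d a := by
    rcases had with h | h
    · exact absurd ⟨d, hd, .inr (by rw [← h]; exact hab)⟩ h2
    · exact h
  by_cases hb : b ∈ D
  · refine ⟨d, b, hd, hb, ?_, ?_, .inl (.inr ⟨a, hda, hab⟩)⟩
    · exact fun h => h2 ⟨b, .inl h, .inl rfl⟩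
    · exact fun h => h2 ⟨b, .inr h, .inl rfl⟩
  · obtain ⟨e, he, hbe⟩ := hD b hb
    refine ⟨d, e, hd, he, ?_, ?_, .inr ⟨a, b, hda, hab, hbe⟩⟩
    · exact fun h => h2 ⟨e, .inl h, .inr hbe.symm⟩
    · exact fun h => h2 ⟨e, .inr h, .inr hbe.symm⟩

namespace IsStubborn

theorem exists_near (h : IsStubborn G D) {x : V} (hx : x ∈ D) : ∃ y ∈ D, y ≠ x ∧ Near G x y :=
  (isSemitotalDominating_iff.1 h.semitotal).2 x hx

theorem exists_mem_ne_ne (h : IsStubborn G D) (x y : V) : ∃ z ∈ D, z ≠ x ∧ z ≠ y := by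
  by_contra! hcon
  have : D ⊆ {x, y} := fun z hz => by
    have := hcon z hz
    simp only [Finset.mem_insert, Finset.mem_singleton]
    tauto
  have h1 := Finset.card_le_card this
  have h2 := Finset.card_le_two (a := x) (b := y)
  have h3 := h.three_le
  omega

/-- An edge inside `D` could be contracted, together with one edge towards the nearest other
vertex of `D`. -/
theorem not_adj (h : IsStubborn G D) {x y : V} (hx : x ∈ D) (hy : y ∈ D) : ¬ G.Adj x y := by
  intro hxy
  obtain ⟨z, hz, hzx, hzy⟩ := h.exists_mem_ne_ne x y
  obtain ⟨d, e, hd, he, hex, hey, hde⟩ :=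
    exists_near_or_path h.connected h.semitotal.1 hz hzx hzy
  have hnear : ∀ t, (t = x ∨ t = y) → ¬ Near G t e := fun t ht hte =>
    h.not_le (contractionNumber_le_two_of_edge h.semitotal.1 h.card_eq.le hxy hx hy
      (fun d hd _ _ => h.exists_near hd) ht he hex hey hte)
  obtain ⟨a, b, hda, hab, hbe⟩ := hde.resolve_left (hnear d hd)
  have hax : a ≠ x := by
    rintro rfl
    exact hnear a (.inl rfl) (.inr ⟨b, hab, hbe⟩)
  have hay : a ≠ y := by
    rintro rfl
    exact hnear a (.inr rfl) (.inr ⟨b, hab, hbe⟩)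
  have hea : e ≠ a := by
    rintro rfl
    exact hnear d hd (.inl hda)
  -- `d'` is the other end of the edge `xy`.
  obtain ⟨d', hd', hd'd, hdd'⟩ : ∃ d', (d' = x ∨ d' = y) ∧ G.Adj d' d ∧
      (∀ t, t ≠ d' → t ≠ d → t ≠ x ∧ t ≠ y) := by
    rcases hd with rfl | rfl
    · exact ⟨y, .inr rfl, hxy.symm, by tauto⟩
    · exact ⟨x, .inl rfl, hxy, by tauto⟩
  refine h.not_le (contractionNumber_le_two_of_path (D := insert a D)
    (p := d') (q := d) (r := a) (t := a) (z := e) ?_ ?_ hd'd hda ?_ ?_ ?_ ?_ ?_ ?_ ?_ ?_ ?_ ?_ ?_)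
  · intro v hv
    obtain ⟨w, hw, hvw⟩ := h.semitotal.1 v fun h => hv (Finset.mem_insert_of_mem h)
    exact ⟨w, Finset.mem_insert_of_mem hw, hvw⟩
  · exact (Finset.card_insert_le _ _).trans (Nat.add_le_add_right h.card_eq.le 1)
  · grind
  · grind
  · grind
  · grind
  · intro v hv _ _ hva
    obtain ⟨w, hw, hne, hn⟩ := h.exists_near ((Finset.mem_insert.1 hv).resolve_left hva)
    exact ⟨w, Finset.mem_insert_of_mem hw, hne, hn⟩
  · grind
  · grind
  · grind
  · grind
  · grind
  · exact .inr ⟨b, hab, hbe⟩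

theorem center_not_mem (h : IsStubborn G D) {x c y : V} (hc : IsCherry G D x c y) : c ∉ D :=
  fun hcD => h.not_adj hc.left_mem hcD hc.adj_left

/-- A third vertex of `D` close to the path `xcy` would be a witness for the vertex resulting from
the contraction of this path. -/
theorem far (h : IsStubborn G D) {x c y z : V} (hc : IsCherry G D x c y) (hz : z ∈ D)
    (hzx : z ≠ x) (hzy : z ≠ y) : Far G x z ∧ Far G c z ∧ Far G y z := by
  have hcD := h.center_not_mem hc
  have key : ∀ t, t = x ∨ t = c ∨ t = y → ¬ Near G t z := fun t ht hn => by
    refine h.not_le (contractionNumber_le_two_of_path (D := insert c D) ?_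
      ((Finset.card_insert_le _ _).trans (Nat.add_le_add_right h.card_eq.le 1))
      hc.adj_left hc.adj_right hc.ne (Finset.mem_insert_of_mem hc.left_mem)
      (Finset.mem_insert_self _ _) (Finset.mem_insert_of_mem hc.right_mem) ?_ ht
      (Finset.mem_insert_of_mem hz) hzx (fun h => hcD (h ▸ hz)) hzy hn)
    · intro v hv
      obtain ⟨w, hw, hvw⟩ := h.semitotal.1 v fun h => hv (Finset.mem_insert_of_mem h)
      exact ⟨w, Finset.mem_insert_of_mem hw, hvw⟩
    · intro v hv _ hvc _
      obtain ⟨w, hw, hne, hn⟩ := h.exists_near ((Finset.mem_insert.1 hv).resolve_left hvc)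
      exact ⟨w, Finset.mem_insert_of_mem hw, hne, hn⟩
  exact ⟨far_of_not_near hzx.symm (key x (.inl rfl)),
    far_of_not_near (fun h => hcD (h ▸ hz)) (key c (.inr (.inl rfl))),
    far_of_not_near hzy.symm (key y (.inr (.inr rfl)))⟩

theorem exists_isCherry (h : IsStubborn G D) {x : V} (hx : x ∈ D) :
    ∃ c y, IsCherry G D x c y := by
  obtain ⟨y, hy, hne, hn⟩ := h.exists_near hx
  obtain ⟨c, h1, h2⟩ := hn.resolve_left (h.not_adj hx hy)
  exact ⟨c, y, hx, hy, hne.symm, h1, h2⟩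

/-- The witness of a vertex outside a cherry lies outside it too. -/
theorem exists_near_ne_left (h : IsStubborn G D) {x c y d : V} (hc : IsCherry G D x c y)
    (hd : d ∈ D) (hdx : d ≠ x) (hdy : d ≠ y) : ∃ e ∈ D, e ≠ x ∧ e ≠ d ∧ Near G d e := by
  obtain ⟨e, he, hne, hn⟩ := h.exists_near hd
  refine ⟨e, he, ?_, hne, hn⟩
  rintro rfl
  exact (h.far hc hd hdx hdy).1.not_near hn.symm

/-- A vertex that is dominated neither by `D \ {x}` nor by the centre `c` is private to `x`. -/
theorem isPrivate (h : IsStubborn G D) {x c y v : V} (hc : IsCherry G D x c y)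
    (hv : v ∉ D.erase x) (hcv : ¬ G.Adj v c) (hdv : ∀ d ∈ D.erase x, ¬ G.Adj v d) :
    IsPrivate G D x c v := by
  have hvx : v ≠ x := by
    rintro rfl
    exact hcv hc.adj_left
  obtain ⟨w, hw, hvw⟩ := h.semitotal.1 v fun h => hv (Finset.mem_erase.2 ⟨hvx, h⟩)
  have hwx : w = x := by
    by_contra hne
    exact hdv w (Finset.mem_erase.2 ⟨hne, hw⟩) hvw
  exact ⟨hwx ▸ hvw.symm, fun h => hcv h.symm, fun d hd hdx h =>
    hdv d (Finset.mem_erase.2 ⟨hdx, hd⟩) h.symm⟩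

/-- If `x` had no private neighbour, it could be replaced by `c`, and the resulting minimum set
would contain the edge `cy`. -/
theorem exists_isPrivate (h : IsStubborn G D) {x c y : V} (hc : IsCherry G D x c y) :
    ∃ u, IsPrivate G D x c u := by
  by_contra! hcon
  have hcD := h.center_not_mem hc
  have hyx := hc.ne.symm
  have hcard : (insert c (D.erase x)).card = D.card := by
    rw [Finset.card_insert_of_notMem (fun h => hcD (Finset.mem_of_mem_erase h)),
      Finset.card_erase_add_one hc.left_mem]
  have hy : y ∈ insert c (D.erase x) := by simp [hyx, hc.right_mem]
  have hS : IsStubborn G (insert c (D.erase x)) := by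
    refine ⟨h.connected, hcard ▸ h.three_le, isSemitotalDominating_iff.2 ⟨?_, ?_⟩,
      hcard.trans h.card_eq, h.not_le⟩
    · intro v hv
      by_contra! hdv
      exact hcon v (h.isPrivate hc
        (fun h => hv (Finset.mem_insert_of_mem h)) (hdv c (Finset.mem_insert_self _ _))
        fun d hd => hdv d (Finset.mem_insert_of_mem hd))
    · intro d hd
      rcases Finset.mem_insert.1 hd with rfl | hd
      · exact ⟨y, hy, hc.adj_right.ne', .inl hc.adj_right⟩
      · obtain ⟨hdx, hd⟩ := Finset.mem_erase.1 hd
        by_cases hdy : d = y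
        · exact ⟨c, Finset.mem_insert_self _ _, fun h' => hcD (h' ▸ hd),
            .inl (hdy ▸ hc.adj_right.symm)⟩
        · obtain ⟨e, he, hex, hed, hn⟩ := h.exists_near_ne_left hc hd hdx hdy
          exact ⟨e, by simp [hex, he], hed, hn⟩
  exact hS.not_adj (Finset.mem_insert_self _ _) hy hc.adj_right

/-- Not all private neighbours of `x` are adjacent to `a`: otherwise `x` could be replaced by `a`
and `c`, and the triangle `yac` contracted. -/
theorem exists_isPrivate_not_adj (h : IsStubborn G D) {x c y a b z : V} (hc : IsCherry G D x c y)
    (hya : G.Adj y a) (hac : G.Adj a c) (hab : G.Adj a b) (hbz : G.Adj b z) (hz : z ∈ D)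
    (hzx : z ≠ x) (hzy : z ≠ y) : ∃ u, IsPrivate G D x c u ∧ ¬ G.Adj a u := by
  by_contra! hcon
  have hcD := h.center_not_mem hc
  have haD : a ∉ D := fun haD => h.not_adj hc.right_mem haD hya
  refine h.not_le (contractionNumber_le_two_of_path (D := insert a (insert c (D.erase x)))
    (t := a) (z := z) ?_ ?_ hya hac hc.adj_right.ne' ?_ ?_ ?_ ?_ (.inr (.inl rfl)) ?_ hzy
    (fun h => haD (h ▸ hz)) (fun h => hcD (h ▸ hz)) (.inr ⟨b, hab, hbz⟩))
  · intro v hv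
    by_contra! hdv
    have := hcon v (h.isPrivate hc (by grind) (hdv c (by simp))
      fun d hd => hdv d (by simp [Finset.mem_of_mem_erase hd, Finset.ne_of_mem_erase hd]))
    exact hdv a (by simp) this.symm
  · have h1 := Finset.card_insert_le a (insert c (D.erase x))
    have h2 := Finset.card_insert_le c (D.erase x)
    have h3 := Finset.card_erase_add_one hc.left_mem
    have h4 := h.card_eq
    omega
  · simp [hc.right_mem, hc.ne.symm]
  · simp
  · simp
  · intro d hd hdy hda hdc
    have hd' : d ≠ x ∧ d ∈ D := by simpa [hda, hdc] using hd
    obtain ⟨e, he, hex, hed, hn⟩ := h.exists_near_ne_left hc hd'.2 hd'.1 hdy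
    exact ⟨e, by simp [hex, he], hed, hn⟩
  · simp [hz, hzx]

end IsStubborn

end

/-! ### Recognizing induced subgraphs -/

section

variable {V : Type u} {G : SimpleGraph V} {D : Finset V}

/-- If distinct vertices of `K` have distinct neighbourhoods, a map from `K` that preserves and
reflects adjacency is injective. -/
theorem isIndContained_of_adj_iff {U : Type*} {K : SimpleGraph U}
    (htwin : ∀ i j, i ≠ j → ∃ k, ¬ (K.Adj i k ↔ K.Adj j k)) {p : U → V}
    (hp : ∀ i j, K.Adj i j ↔ G.Adj (p i) (p j)) : K.IsIndContained G := by
  refine ⟨⟨⟨p, fun i j hij => ?_⟩, fun {i j} => (hp i j).symm⟩⟩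
  by_contra hne
  obtain ⟨k, hk⟩ := htwin i j hne
  exact hk (by rw [hp, hp, hij])

theorem isIndContained_pathGraph_eight_of_adj {a b c d e f g h : V}
    (hadj : G.Adj a b ∧ G.Adj b c ∧ G.Adj c d ∧ G.Adj d e ∧ G.Adj e f ∧ G.Adj f g ∧ G.Adj g h)
    (ha : ¬ G.Adj a c ∧ ¬ G.Adj a d ∧ ¬ G.Adj a e ∧ ¬ G.Adj a f ∧ ¬ G.Adj a g ∧ ¬ G.Adj a h)
    (hb : ¬ G.Adj b d ∧ ¬ G.Adj b e ∧ ¬ G.Adj b f ∧ ¬ G.Adj b g ∧ ¬ G.Adj b h)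
    (hc : ¬ G.Adj c e ∧ ¬ G.Adj c f ∧ ¬ G.Adj c g ∧ ¬ G.Adj c h)
    (hd : ¬ G.Adj d f ∧ ¬ G.Adj d g ∧ ¬ G.Adj d h)
    (he : ¬ G.Adj e g ∧ ¬ G.Adj e h) (hf : ¬ G.Adj f h) :
    (SimpleGraph.pathGraph 8).IsIndContained G := by
  refine isIndContained_of_adj_iff ?_ (p := ![a, b, c, d, e, f, g, h]) fun i j => ?_
  · simp only [SimpleGraph.pathGraph_adj]
    decide
  · fin_cases i <;> fin_cases j <;> simp [SimpleGraph.pathGraph_adj] <;>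
      grind [SimpleGraph.adj_comm]

theorem isIndContained_two_pathGraph_four_of_adj {a b c d e f g h : V}
    (hadj : G.Adj a b ∧ G.Adj b c ∧ G.Adj c d) (hadj' : G.Adj e f ∧ G.Adj f g ∧ G.Adj g h)
    (hl : ¬ G.Adj a c ∧ ¬ G.Adj a d ∧ ¬ G.Adj b d)
    (hr : ¬ G.Adj e g ∧ ¬ G.Adj e h ∧ ¬ G.Adj f h)
    (ha : ¬ G.Adj a e ∧ ¬ G.Adj a f ∧ ¬ G.Adj a g ∧ ¬ G.Adj a h)
    (hb : ¬ G.Adj b e ∧ ¬ G.Adj b f ∧ ¬ G.Adj b g ∧ ¬ G.Adj b h)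
    (hc : ¬ G.Adj c e ∧ ¬ G.Adj c f ∧ ¬ G.Adj c g ∧ ¬ G.Adj c h)
    (hd : ¬ G.Adj d e ∧ ¬ G.Adj d f ∧ ¬ G.Adj d g ∧ ¬ G.Adj d h) :
    (SimpleGraph.pathGraph 4 ⊕g SimpleGraph.pathGraph 4).IsIndContained G := by
  refine isIndContained_of_adj_iff ?_ (p := Sum.elim ![a, b, c, d] ![e, f, g, h]) ?_
  · have htwin : ∀ i j : Fin 4, i ≠ j →
        ∃ k, ¬ ((SimpleGraph.pathGraph 4).Adj i k ↔ (SimpleGraph.pathGraph 4).Adj j k) := by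
      simp only [SimpleGraph.pathGraph_adj]
      decide
    have hnbr : ∀ i : Fin 4, ∃ k, (SimpleGraph.pathGraph 4).Adj i k := by
      simp only [SimpleGraph.pathGraph_adj]
      decide
    rintro (i | i) (j | j) hij
    · obtain ⟨k, hk⟩ := htwin i j (fun h => hij (congrArg _ h))
      exact ⟨.inl k, by simpa using hk⟩
    · obtain ⟨k, hk⟩ := hnbr i
      exact ⟨.inl k, by simpa using hk⟩
    · obtain ⟨k, hk⟩ := hnbr i
      exact ⟨.inr k, by simpa using hk⟩
    · obtain ⟨k, hk⟩ := htwin i j (fun h => hij (congrArg _ h))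
      exact ⟨.inr k, by simpa using hk⟩
  · rintro (i | i) (j | j) <;> fin_cases i <;> fin_cases j <;>
      simp [SimpleGraph.pathGraph_adj] <;> grind [SimpleGraph.adj_comm]

/-! ### Finding the induced subgraphs -/

section

variable {x c y x' c' y' a b u u' : V}

namespace IsStubborn

/-- The induced path is `x c y a b x' c' y'`. -/
theorem isIndContained_pathGraph_eight_of_not_adj_of_not_adj (h : IsStubborn G D)
    (hc : IsCherry G D x c y) (hc' : IsCherry G D x' c' y') (hxx : x' ≠ x) (hxy : x' ≠ y)
    (hyx : y' ≠ x) (hyy : y' ≠ y) (hya : G.Adj y a) (hab : G.Adj a b) (hbx : G.Adj b x')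
    (hac : ¬ G.Adj a c) (hbc : ¬ G.Adj b c') :
    (SimpleGraph.pathGraph 8).IsIndContained G := by
  -- If `a` were adjacent to `x`, it would be the centre of a cherry close to `x'`.
  have hax : ¬ G.Adj a x := fun hax => (h.far ⟨hc.left_mem, hc.right_mem, hc.ne, hax.symm,
    hya.symm⟩ hc'.left_mem hxx hxy).2.1.not_adj_of_adj b hab hbx
  have hby : ¬ G.Adj b y' := fun hby => (h.far ⟨hc'.left_mem, hc'.right_mem, hc'.ne, hbx.symm,
    hby⟩ hc.right_mem hxy.symm hyy.symm).2.1.not_adj_of_adj a hab.symm hya.symm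
  have h1 := h.not_adj hc.left_mem hc.right_mem
  have h2 := h.not_adj hc'.left_mem hc'.right_mem
  obtain ⟨f1, f2, f3⟩ := h.far hc hc'.left_mem hxx hxy
  obtain ⟨f4, f5, f6⟩ := h.far hc hc'.right_mem hyx hyy
  obtain ⟨f7, f8, f9⟩ := h.far hc' hc.left_mem hxx.symm hyx.symm
  obtain ⟨f10, f11, f12⟩ := h.far hc' hc.right_mem hxy.symm hyy.symm
  obtain ⟨-, -, -, c1, c2⟩ := hc
  obtain ⟨-, -, -, c3, c4⟩ := hc'
  apply isIndContained_pathGraph_eight_of_adj (a := x) (b := c) (c := y) (d := a) (e := b)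
    (f := x') (g := c') (h := y') <;> grind [Far, SimpleGraph.adj_comm]

/-- The induced path is `u x c a b x' c' y'`, unless `u` is adjacent to `b`; then `x u b x'` takes
the role of `y a b x'`, and `u` is not adjacent to `c`. -/
theorem isIndContained_pathGraph_eight_of_adj_of_not_adj (h : IsStubborn G D)
    (hc : IsCherry G D x c y) (hc' : IsCherry G D x' c' y') (hxx : x' ≠ x) (hxy : x' ≠ y)
    (hyx : y' ≠ x) (hyy : y' ≠ y) (hya : G.Adj y a) (hab : G.Adj a b) (hbx : G.Adj b x')
    (hac : G.Adj a c) (hbc : ¬ G.Adj b c') (hu : IsPrivate G D x c u) (hau : ¬ G.Adj a u) :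
    (SimpleGraph.pathGraph 8).IsIndContained G := by
  by_cases hub : G.Adj u b
  · exact h.isIndContained_pathGraph_eight_of_not_adj_of_not_adj hc.symm hc' hxy hxx hyy hyx
      hu.adj hub hbx (fun h => hu.not_adj_center h.symm) hbc
  have hax : ¬ G.Adj a x := fun hax => (h.far ⟨hc.left_mem, hc.right_mem, hc.ne, hax.symm,
    hya.symm⟩ hc'.left_mem hxx hxy).2.1.not_adj_of_adj b hab hbx
  have hby : ¬ G.Adj b y' := fun hby => (h.far ⟨hc'.left_mem, hc'.right_mem, hc'.ne, hbx.symm,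
    hby⟩ hc.right_mem hxy.symm hyy.symm).2.1.not_adj_of_adj a hab.symm hya.symm
  have h1 := h.not_adj hc.left_mem hc.right_mem
  have h2 := h.not_adj hc'.left_mem hc'.right_mem
  obtain ⟨f1, f2, f3⟩ := h.far hc hc'.left_mem hxx hxy
  obtain ⟨f4, f5, f6⟩ := h.far hc hc'.right_mem hyx hyy
  obtain ⟨f7, f8, f9⟩ := h.far hc' hc.left_mem hxx.symm hyx.symm
  obtain ⟨f10, f11, f12⟩ := h.far hc' hc.right_mem hxy.symm hyy.symm
  have u1 := hu.not_adj _ hc'.left_mem hxx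
  have u2 := hu.not_adj _ hc'.right_mem hyx
  obtain ⟨u3, u4, -⟩ := hu
  obtain ⟨-, -, -, c1, c2⟩ := hc
  obtain ⟨-, -, -, c3, c4⟩ := hc'
  apply isIndContained_pathGraph_eight_of_adj (a := u) (b := x) (c := c) (d := a) (e := b)
    (f := x') (g := c') (h := y') <;> grind [Far, SimpleGraph.adj_comm]

/-- The induced path is `u x c a b c' y' u'`, unless there is an edge `uu'`, `ub` or `au'`. Such an
edge is the middle of another path of length three between the two cherries, and since private
neighbours are not adjacent to the centres, this path falls under one of the previous cases. -/
theorem isIndContained_pathGraph_eight_of_adj_of_adj (h : IsStubborn G D)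
    (hc : IsCherry G D x c y) (hc' : IsCherry G D x' c' y') (hxx : x' ≠ x) (hxy : x' ≠ y)
    (hyx : y' ≠ x) (hyy : y' ≠ y) (hya : G.Adj y a) (hab : G.Adj a b) (hbx : G.Adj b x')
    (hac : G.Adj a c) (hbc : G.Adj b c') (hu : IsPrivate G D x c u) (hau : ¬ G.Adj a u)
    (hu' : IsPrivate G D y' c' u') (hbu : ¬ G.Adj b u') :
    (SimpleGraph.pathGraph 8).IsIndContained G := by
  by_cases huu : G.Adj u u'
  · exact h.isIndContained_pathGraph_eight_of_not_adj_of_not_adj hc.symm hc'.symm hyy hyx hxy hxx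
      hu.adj huu hu'.adj.symm (fun h => hu.not_adj_center h.symm)
      (fun h => hu'.not_adj_center h.symm)
  by_cases hub : G.Adj u b
  · exact h.isIndContained_pathGraph_eight_of_adj_of_not_adj hc'.symm hc
      hyx.symm hxx.symm hyy.symm hxy.symm hbx.symm hub.symm hu.adj.symm hbc
      (fun h => hu.not_adj_center h.symm) hu' hbu
  by_cases hau' : G.Adj a u'
  · exact h.isIndContained_pathGraph_eight_of_adj_of_not_adj hc hc'.symm hyx hyy hxx hxy hya hau'
      hu'.adj.symm hac (fun h => hu'.not_adj_center h.symm) hu hau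
  have hax : ¬ G.Adj a x := fun hax => (h.far ⟨hc.left_mem, hc.right_mem, hc.ne, hax.symm,
    hya.symm⟩ hc'.left_mem hxx hxy).2.1.not_adj_of_adj b hab hbx
  have hby : ¬ G.Adj b y' := fun hby => (h.far ⟨hc'.left_mem, hc'.right_mem, hc'.ne, hbx.symm,
    hby⟩ hc.right_mem hxy.symm hyy.symm).2.1.not_adj_of_adj a hab.symm hya.symm
  obtain ⟨f1, f2, f3⟩ := h.far hc hc'.left_mem hxx hxy
  obtain ⟨f4, f5, f6⟩ := h.far hc hc'.right_mem hyx hyy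
  obtain ⟨f7, f8, f9⟩ := h.far hc' hc.left_mem hxx.symm hyx.symm
  obtain ⟨f10, f11, f12⟩ := h.far hc' hc.right_mem hxy.symm hyy.symm
  have u2 := hu.not_adj _ hc'.right_mem hyx
  have u5 := hu'.not_adj _ hc.left_mem hyx.symm
  obtain ⟨u3, u4, -⟩ := hu
  obtain ⟨u6, u7, -⟩ := hu'
  obtain ⟨-, -, -, c1, c2⟩ := hc
  obtain ⟨-, -, -, c3, c4⟩ := hc'
  apply isIndContained_pathGraph_eight_of_adj (a := u) (b := x) (c := c) (d := a) (e := b)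
    (f := c') (g := y') (h := u') <;> grind [Far, SimpleGraph.adj_comm]

theorem exists_two_cherries (h : IsStubborn G D) : ∃ x c y x' c' y', IsCherry G D x c y ∧
    IsCherry G D x' c' y' ∧ x' ≠ x ∧ x' ≠ y ∧ y' ≠ x ∧ y' ≠ y ∧
      ∃ a b, G.Adj y a ∧ G.Adj a b ∧ G.Adj b x' := by
  obtain ⟨x, hx⟩ : D.Nonempty := by
    rw [← Finset.card_pos]
    have := h.three_le
    omega
  obtain ⟨c, y, hc⟩ := h.exists_isCherry hx
  obtain ⟨z, hz, hzx, hzy⟩ := h.exists_mem_ne_ne x y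
  obtain ⟨d, x', hd, hx', hxx, hxy, hn⟩ := exists_near_or_path h.connected h.semitotal.1 hz hzx hzy
  obtain ⟨f1, -, f2⟩ := h.far hc hx' hxx hxy
  obtain ⟨c', y', hc'⟩ := h.exists_isCherry hx'
  have hyx : y' ≠ x := by
    rintro rfl
    exact f1.symm.not_adj_of_adj c' hc'.adj_left hc'.adj_right
  have hyy : y' ≠ y := by
    rintro rfl
    exact f2.symm.not_adj_of_adj c' hc'.adj_left hc'.adj_right
  rcases hd with rfl | rfl
  · exact ⟨y, c, d, x', c', y', hc.symm, hc', hxy, hxx, hyy, hyx, hn.resolve_left f1.not_near⟩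
  · exact ⟨x, c, d, x', c', y', hc, hc', hxx, hxy, hyx, hyy, hn.resolve_left f2.not_near⟩

theorem isIndContained_pathGraph_eight (h : IsStubborn G D) :
    (SimpleGraph.pathGraph 8).IsIndContained G := by
  obtain ⟨x, c, y, x', c', y', hc, hc', hxx, hxy, hyx, hyy, a, b, hya, hab, hbx⟩ :=
    h.exists_two_cherries
  have hu := fun hac : G.Adj a c =>
    h.exists_isPrivate_not_adj hc hya hac hab hbx hc'.left_mem hxx hxy
  have hu' := fun hbc : G.Adj b c' => h.exists_isPrivate_not_adj hc'.symm hbx.symm hbc hab.symm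
    hya.symm hc.right_mem hyy.symm hxy.symm
  by_cases hac : G.Adj a c <;> by_cases hbc : G.Adj b c'
  · obtain ⟨u, hu, hau⟩ := hu hac
    obtain ⟨u', hu', hbu⟩ := hu' hbc
    exact h.isIndContained_pathGraph_eight_of_adj_of_adj hc hc' hxx hxy hyx hyy hya hab hbx hac hbc
      hu hau hu' hbu
  · obtain ⟨u, hu, hau⟩ := hu hac
    exact h.isIndContained_pathGraph_eight_of_adj_of_not_adj hc hc' hxx hxy hyx hyy hya hab hbx
      hac hbc hu hau
  · obtain ⟨u', hu', hbu⟩ := hu' hbc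
    exact h.isIndContained_pathGraph_eight_of_adj_of_not_adj hc'.symm hc.symm hyy.symm hxy.symm
      hyx.symm hxx.symm hbx.symm hab.symm hya.symm hbc hac hu' hbu
  · exact h.isIndContained_pathGraph_eight_of_not_adj_of_not_adj hc hc' hxx hxy hyx hyy hya hab
      hbx hac hbc

/-- Non-adjacent private neighbours `u` of `x` and `u'` of `x'` give the paths `uxcy` and
`u'x'c'y'`. -/
theorem isIndContained_two_pathGraph_four_of_not_adj (h : IsStubborn G D)
    (hc : IsCherry G D x c y) (hc' : IsCherry G D x' c' y') (hxx : x' ≠ x) (hxy : x' ≠ y)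
    (hyx : y' ≠ x) (hyy : y' ≠ y) (hu : IsPrivate G D x c u) (hu' : IsPrivate G D x' c' u')
    (huu : ¬ G.Adj u u') :
    (SimpleGraph.pathGraph 4 ⊕g SimpleGraph.pathGraph 4).IsIndContained G := by
  have h1 := h.not_adj hc.left_mem hc.right_mem
  have h2 := h.not_adj hc'.left_mem hc'.right_mem
  obtain ⟨f1, f2, f3⟩ := h.far hc hc'.left_mem hxx hxy
  obtain ⟨f4, f5, f6⟩ := h.far hc hc'.right_mem hyx hyy
  obtain ⟨f7, f8, f9⟩ := h.far hc' hc.left_mem hxx.symm hyx.symm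
  obtain ⟨f10, f11, f12⟩ := h.far hc' hc.right_mem hxy.symm hyy.symm
  have u1 := hu.not_adj _ hc'.left_mem hxx
  have u2 := hu.not_adj _ hc'.right_mem hyx
  have u3 := hu.not_adj _ hc.right_mem hc.ne.symm
  have u4 := hu'.not_adj _ hc.left_mem hxx.symm
  have u5 := hu'.not_adj _ hc.right_mem hxy.symm
  have u6 := hu'.not_adj _ hc'.right_mem hc'.ne.symm
  obtain ⟨v1, v2, -⟩ := hu
  obtain ⟨v3, v4, -⟩ := hu'
  obtain ⟨-, -, -, c1, c2⟩ := hc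
  obtain ⟨-, -, -, c3, c4⟩ := hc'
  apply isIndContained_two_pathGraph_four_of_adj (a := u) (b := x) (c := c) (d := y) (e := u')
    (f := x') (g := c') (h := y') <;> grind [Far, SimpleGraph.adj_comm]

open scoped Classical in
/-- If there is no induced `2P₄`, then a private neighbour `u'` of `x'` is adjacent to all private
neighbours of `x` and to one of `y`. So `x` can be replaced by `c` and `u'`, and the edges `yc` and
`x'u'` contracted. -/
theorem isIndContained_two_pathGraph_four (h : IsStubborn G D) :
    (SimpleGraph.pathGraph 4 ⊕g SimpleGraph.pathGraph 4).IsIndContained G := by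
  by_contra hfree
  obtain ⟨x, c, y, x', c', y', hc, hc', hxx, hxy, hyx, hyy, -⟩ := h.exists_two_cherries
  obtain ⟨u', hu'⟩ := h.exists_isPrivate hc'
  obtain ⟨w, hw⟩ := h.exists_isPrivate hc.symm
  have hwu : G.Adj w u' := by
    by_contra hwu
    exact hfree (h.isIndContained_two_pathGraph_four_of_not_adj hc.symm hc' hxy hxx hyy hyx hw hu'
      hwu)
  have huu : ∀ u, IsPrivate G D x c u → G.Adj u u' := fun u hu => by
    by_contra huu
    exact hfree (h.isIndContained_two_pathGraph_four_of_not_adj hc hc' hxx hxy hyx hyy hu hu' huu)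
  have hcD := h.center_not_mem hc
  obtain ⟨-, f, -⟩ := h.far hc hc'.left_mem hxx hxy
  refine h.not_le (contractionNumber_le_two_of_two_edges (D := insert u' (insert c (D.erase x)))
    (p := y) (q := c) (r := u') (s := x') ?_ ?_ hc.adj_right.symm hu'.adj.symm ?_ hxy.symm ?_ f.ne
    ?_ ?_ ?_ ?_ ?_ ?_)
  · intro v hv
    by_contra! hdv
    have := huu v (h.isPrivate hc (by grind) (hdv c (by simp))
      fun d hd => hdv d (by simp [Finset.mem_of_mem_erase hd, Finset.ne_of_mem_erase hd]))
    exact hdv u' (by simp) this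
  · have h1 := Finset.card_insert_le u' (insert c (D.erase x))
    have h2 := Finset.card_insert_le c (D.erase x)
    have h3 := Finset.card_erase_add_one hc.left_mem
    have h4 := h.card_eq
    omega
  · rintro rfl
    exact h.not_adj hc'.left_mem hc.right_mem hu'.adj
  · rintro rfl
    exact f.not_adj hu'.adj.symm
  · simp [hc.right_mem, hc.ne.symm]
  · simp
  · simp
  · simp [hc'.left_mem, hxx]
  · intro d hd hdy hdc hdu _
    have hd' : d ≠ x ∧ d ∈ D := by simpa [hdu, hdc] using hd
    obtain ⟨e, he, hex, hed, hn⟩ := h.exists_near_ne_left hc hd'.2 hd'.1 hdy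
    exact ⟨e, by simp [hex, he], hed, hn⟩
  · exact .inr ⟨w, hw.adj, hwu⟩

end IsStubborn

end

open scoped Classical in
theorem exists_isStubborn (hconn : G.Connected) (hγ : 3 ≤ semitotalDominationNumber G)
    (h : ¬ contractionNumber semitotalDominationNumber G ≤ 2) : ∃ D, IsStubborn G D := by
  have hex : ∃ D : Finset V, IsSemitotalDominating G D := by
    by_contra hcon
    have : semitotalDominationNumber G = 0 :=
      Nat.sInf_eq_zero.2 (.inr (Set.eq_empty_of_forall_notMem fun n hn =>
        hcon (hn.imp fun D hD => hD.1)))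
    omega
  obtain ⟨D, hD, hc⟩ := exists_card_eq_semitotalDominationNumber hex
  exact ⟨D, hconn, hc ▸ hγ, hD, hc, h⟩

end

end SemitotalContraction

theorem mainTheorem7 {V : Type u} [Finite V] (G : SimpleGraph V) (hconn : G.Connected)
    (hγ : 3 ≤ SemitotalContraction.semitotalDominationNumber G) :
    (SemitotalContraction.IsFree (SimpleGraph.pathGraph 8) G →
      SemitotalContraction.contractionNumber
        SemitotalContraction.semitotalDominationNumber G ≤ 2) ∧
    (SemitotalContraction.IsFree (SimpleGraph.pathGraph 4 ⊕g SimpleGraph.pathGraph 4) G →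
      SemitotalContraction.contractionNumber
        SemitotalContraction.semitotalDominationNumber G ≤ 2) := by
  constructor <;> intro hfree <;> by_contra hcon <;>
    obtain ⟨D, hD⟩ := SemitotalContraction.exists_isStubborn hconn hγ hcon
  · exact hfree hD.isIndContained_pathGraph_eight
  · exact hfree hD.isIndContained_two_pathGraph_four
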